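/- Let $\mathbb{K}$ be a field and let $F=\mathbb{K}(q)$ be the field of rational functions over $\mathbb{K}$. Let $\mathcal{A}$ be the graded $F$-vector space with basis the isomorphism classes of finite simplicial complexes $\Gamma$, graded by the number of vertices, $\mathcal{A}=\bigoplus_{n\ge 0}A_n$, with coproduct $\Delta(\Gamma)=\sum_{T\subseteq V(\Gamma)}\Gamma_T\otimes\Gamma_{V(\Gamma)-T}$, where $\Gamma_T$ is the induced subcomplex on $T$, and with counit equal to $1$ on the complex without vertices and $0$ on all other complexes. For an integer $s\ge 1$ and $r\in F$ let $\zeta_{s,r}:\mathcal{A}\to F$ be the linear map with $$\zeta_{s,r}(\Gamma)=\begin{cases} r^{\,\mathrm{rk}(\Gamma^{(1)})} & \text{if }\dim\Gamma<s,\\ 0 & \text{if }\dim\Gamma\ge s,\end{cases}$$ where $\mathrm{rk}(\Gamma^{(1)})$ is the number of edges of a maximal spanning forest of the $1$-skeleton $\Gamma^{(1)}$. For a linear map $\zeta:\mathcal{A}\to F$ and a composition $\alpha=(\alpha_1,\dots,\alpha_k)$ let $\zeta_\alpha$ be the composite $$\mathcal{A}\xrightarrow{\Delta^{k-1}}\mathcal{A}^{\otimes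 k}\to A_{\alpha_1}\otimes\cdots\otimes A_{\alpha_k}\xrightarrow{\zeta^{\otimes k}}F$$ of the iterated coproduct, the canonical projection and $\zeta^{\otimes k}$ (for $k=0$ it is the counit), and let $\Psi_\zeta(h)=\sum_{\alpha\vDash n}\zeta_\alpha(h)M_\alpha$ for $h\in A_n$, where $M_\alpha=\sum_{i_1<\cdots<i_k}x_{i_1}^{\alpha_1}\cdots x_{i_k}^{\alpha_k}$ is the monomial quasi-symmetric function. For a quasi-symmetric function $f$ let $ps^1(f)(t)$, $t\in\mathbb{Z}$, be its principal specialization: the unique $F$-linear combination of the binomial polynomials $\binom{t}{k}$, $k\ge 0$, whose value at every integer $t\ge 0$ is $f$ evaluated at $x_1=\cdots=x_t=1$ and $x_i=0$ for $i>t$. **Proposition.** Let $T_n$ be any tree with $n$ vertices, regarded as a simplicial complex of dimension at most $1$, and let $s>1$ be an integer. Then $$ps^1\big(\Psi_{\zeta_{s,-q}}(T_n)\big)(-1)=(-1)^n(q+2)^{n-1}.$$ -/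

import Mathlib

open scoped TensorProduct

namespace SimplicialHopf

universe u v

/-! ### Simplicial complexes and their isomorphism classes -/

/-- A finite abstract simplicial complex. The ground set `V` is exactly the vertex set
(`AbstractSimplicialComplex` requires all singletons to be faces; the empty face is left implicit). -/
structure Complex : Type (u + 1) where
  V : Type u
  [finite : Finite V]
  faces : AbstractSimplicialComplex V

attribute [instance] Complex.finite

namespace Complex

/-- The dimension, i.e. the maximum of `|X| - 1` over the faces `X`
(faces are nonempty; the complex without vertices has dimension `⊥`). -/
noncomputable def dim (Γ : Complex.{u}) : WithBot ℕ∞ :=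
  ⨆ X ∈ Γ.faces, ((X.card - 1 : ℕ) : WithBot ℕ∞)

/-- The 1-skeleton, as a simple graph. -/
def skeletonOne (Γ : Complex.{u}) : SimpleGraph Γ.V where
  Adj a b := a ≠ b ∧ ∃ X ∈ Γ.faces, ∀ x, x ∈ X ↔ x = a ∨ x = b
  symm := ⟨by
    rintro a b ⟨h, X, hX, hx⟩
    exact ⟨h.symm, X, hX, fun x => (hx x).trans or_comm⟩⟩
  loopless := ⟨fun _ h => h.1 rfl⟩

/-- The induced complex `Γ_T`: its faces are the faces of `Γ` contained in `T`. -/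
def induced (Γ : Complex.{u}) (T : Set Γ.V) : Complex.{u} where
  V := T
  faces :=
    { faces := {X | X.map (Function.Embedding.subtype (· ∈ T)) ∈ Γ.faces}
      isRelLowerSet_faces := by
        intro X hX
        have h := Γ.faces.isRelLowerSet_faces hX
        exact ⟨by simpa using h.1, fun Y hYX hY =>
          h.2 (Finset.map_subset_map.2 hYX) (by simpa using hY)⟩
      singleton_mem := fun v => by
        have h : {v.1} ∈ Γ.faces := Γ.faces.singleton_mem v.1
        simpa using h }

/-- `e` is an isomorphism of simplicial complexes. -/
def IsIso (Γ Θ : Complex.{u}) (e : Γ.V ≃ Θ.V) : Prop :=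
  ∀ X : Finset Γ.V, X ∈ Γ.faces ↔ X.map e.toEmbedding ∈ Θ.faces

theorem IsIso.refl (Γ : Complex.{u}) : IsIso Γ Γ (Equiv.refl _) := fun X => by simp

theorem IsIso.symm {Γ Θ : Complex.{u}} {e : Γ.V ≃ Θ.V} (h : IsIso Γ Θ e) :
    IsIso Θ Γ e.symm := fun X => by
  have := h (X.map e.symm.toEmbedding)
  rw [this, Finset.map_map]
  simp

theorem IsIso.trans {Γ Θ Λ : Complex.{u}} {e : Γ.V ≃ Θ.V} {f : Θ.V ≃ Λ.V}
    (h : IsIso Γ Θ e) (k : IsIso Θ Λ f) : IsIso Γ Λ (e.trans f) := fun X => by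
  rw [h X, k _, Finset.map_map]
  rfl

instance setoid : Setoid Complex.{u} where
  r Γ Θ := ∃ e : Γ.V ≃ Θ.V, IsIso Γ Θ e
  iseqv :=
    { refl := fun Γ => ⟨_, IsIso.refl Γ⟩
      symm := fun ⟨_, h⟩ => ⟨_, h.symm⟩
      trans := fun ⟨_, h⟩ ⟨_, k⟩ => ⟨_, h.trans k⟩ }

end Complex

/-- Isomorphism classes of finite simplicial complexes. -/
def IsoClass : Type (u + 1) := Quotient Complex.setoid.{u}

/-- The isomorphism class `[Γ]`. -/
def Complex.cls (Γ : Complex.{u}) : IsoClass.{u} := Quotient.mk _ Γ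

/-- The number of vertices of (a representative of) an isomorphism class. -/
noncomputable def IsoClass.order (c : IsoClass.{u}) : ℕ :=
  Quotient.lift (fun Γ : Complex.{u} => Nat.card Γ.V)
    (by rintro _ _ ⟨e, _⟩; exact Nat.card_congr e) c

/-- The rank of a finite graph in its cycle matroid: the number of edges of a maximum spanning
forest. -/
noncomputable def graphRank {V : Type u} (G : SimpleGraph V) : ℕ :=
  sSup {k | ∃ H : SimpleGraph V, H ≤ G ∧ H.IsAcyclic ∧ H.edgeSet.ncard = k}

/-! ### The graded coalgebra of simplicial complexes -/

section Coalgebra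

variable (R : Type v) [CommRing R]

/-- The free `R`-module `𝒜` on the isomorphism classes of finite simplicial complexes. -/
abbrev Alg : Type (max (u + 1) v) := IsoClass.{u} →₀ R

/-- The basis element of `𝒜` given by a simplicial complex. -/
noncomputable def basisElt (Γ : Complex.{u}) : Alg.{u, v} R := Finsupp.single Γ.cls 1

/-- The homogeneous component `A_n`, spanned by the complexes with `n` vertices. -/
def component (n : ℕ) : Submodule R (Alg.{u, v} R) :=
  Finsupp.supported R R {c | c.order = n}

/-- The canonical projection `𝒜 → A_n`, viewed as an endomorphism of `𝒜`. -/
noncomputable def proj (n : ℕ) : Alg.{u, v} R →ₗ[R] Alg.{u, v} R :=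
  (component R n).subtype ∘ₗ Finsupp.restrictDom R R {c : IsoClass.{u} | c.order = n}

theorem Complex.IsIso.induced_cls {Γ Θ : Complex.{u}} {e : Γ.V ≃ Θ.V} (h : IsIso Γ Θ e)
    (T : Set Γ.V) : (Γ.induced T).cls = (Θ.induced (e '' T)).cls := by
  have key : ∀ X : Finset T, X.map (Function.Embedding.subtype (· ∈ T)) ∈ Γ.faces ↔
      (X.map (e.image T).toEmbedding).map (Function.Embedding.subtype (· ∈ e '' T)) ∈ Θ.faces := by
    intro X
    rw [h]
    rw [Finset.map_map, Finset.map_map]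
    rfl
  exact Quotient.sound ⟨e.image T, key⟩

/-- The coproduct of a complex, `Δ(Γ) = ∑_{T ⊆ V(Γ)} Γ_T ⊗ Γ_{V(Γ) - T}`. -/
noncomputable def comulComplex (Γ : Complex.{u}) : Alg.{u, v} R ⊗[R] Alg.{u, v} R :=
  ∑ᶠ T : Set Γ.V, basisElt R (Γ.induced T) ⊗ₜ[R] basisElt R (Γ.induced Tᶜ)

/-- The coproduct `Δ : 𝒜 → 𝒜 ⊗ 𝒜`. -/
noncomputable def comul : Alg.{u, v} R →ₗ[R] Alg.{u, v} R ⊗[R] Alg.{u, v} R :=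
  Finsupp.linearCombination R fun c : IsoClass.{u} =>
    Quotient.lift (comulComplex R) (by
      rintro Γ Θ ⟨e, h⟩
      unfold comulComplex
      rw [← finsum_comp_equiv (Equiv.Set.congr e)]
      refine finsum_congr fun T => ?_
      have h₁ := h.induced_cls T
      have h₂ := h.induced_cls Tᶜ
      rw [Set.image_compl_eq e.bijective] at h₂
      simp only [basisElt, h₁, h₂]
      rfl) c

/-- The counit `ε : 𝒜 → R`, which is `1` on the complex without vertices and `0` on all other
complexes. -/
noncomputable def counit : Alg.{u, v} R →ₗ[R] R :=
  Finsupp.linearCombination R fun c : IsoClass.{u} => if c.order = 0 then 1 else 0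

/-- The iterated coproduct `𝒜 → 𝒜^{⊗ k}` (usually written `Δ^{k-1}`): it is `ε` for `k = 0`,
and `Δ^{k} = (Δ^{k-1} ⊗ id) ∘ Δ`. -/
noncomputable def iterComul : (k : ℕ) → Alg.{u, v} R →ₗ[R] ⨂[R]^k (Alg.{u, v} R)
  | 0 => (PiTensorProduct.isEmptyEquiv (Fin 0)).symm.toLinearMap ∘ₗ counit R
  | k + 1 =>
    (TensorPower.mulEquiv (R := R) (M := Alg.{u, v} R) (n := k) (m := 1)).toLinearMap ∘ₗ
      TensorProduct.map (iterComul k)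
        (PiTensorProduct.subsingletonEquiv (0 : Fin 1)).symm.toLinearMap ∘ₗ comul R

variable {R}

/-- `ζ_α`, the composite `𝒜 → 𝒜^{⊗ k} → A_{α₁} ⊗ ⋯ ⊗ A_{αₖ} → R` of the iterated coproduct, the
canonical projection and `ζ^{⊗ k}`. -/
noncomputable def zetaComp (ζ : Alg.{u, v} R →ₗ[R] R) {n : ℕ} (α : Composition n) :
    Alg.{u, v} R →ₗ[R] R :=
  PiTensorProduct.lift
      ((MultilinearMap.mkPiAlgebra R (Fin α.length) R).compLinearMap fun i =>
        ζ ∘ₗ proj R (α.blocksFun i)) ∘ₗ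
    iterComul R α.length

end Coalgebra

/-! ### Quasi-symmetric functions -/

section QuasiSymmetric

variable (R : Type v) [CommRing R]

open Classical in
/-- The monomial quasi-symmetric function
`M_α = ∑_{i₁ < ⋯ < iₗ} x_{i₁}^{α₁} ⋯ x_{iₗ}^{αₗ}`, a formal power series in the variables
`x_0, x_1, x_2, …`. As the parts are positive, each monomial arises from at most one sequence
`i₁ < ⋯ < iₗ`, so that all coefficients are `0` or `1`. -/
noncomputable def monomialQSym {n : ℕ} (α : Composition n) : MvPowerSeries ℕ R := fun m =>
  if ∃ i : Fin α.length → ℕ, StrictMono i ∧ m = ∑ j, Finsupp.single (i j) (α.blocksFun j)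
  then 1 else 0

/-- The module of quasi-symmetric functions, spanned by the `M_α`. -/
noncomputable def QSym : Submodule R (MvPowerSeries ℕ R) :=
  Submodule.span R (Set.range fun a : Σ n, Composition n => monomialQSym R a.2)

theorem monomialQSym_mem {n : ℕ} (α : Composition n) : monomialQSym R α ∈ QSym R :=
  Submodule.subset_span ⟨⟨n, α⟩, rfl⟩

variable {R}

/-- The map `Ψ_ζ : 𝒜 → QSym` given by `Ψ_ζ(h) = ∑_{α ⊨ n} ζ_α(h) M_α` for `h ∈ A_n`. -/
noncomputable def psi (ζ : Alg.{u, v} R →ₗ[R] R) : Alg.{u, v} R →ₗ[R] QSym R :=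
  Finsupp.linearCombination R fun c : IsoClass.{u} =>
    ∑ α : Composition c.order,
      zetaComp ζ α (Finsupp.single c 1) • (⟨monomialQSym R α, monomialQSym_mem R α⟩ : QSym R)

/-- The value of a quasi-symmetric function when its first `t` variables are set to `1` and all
other variables to `0`. (Quasi-symmetric functions have bounded degree, so that only finitely many
terms are nonzero.) -/
noncomputable def evalOnes (f : QSym R) (t : ℕ) : R :=
  ∑ᶠ m : ℕ →₀ ℕ, MvPowerSeries.coeff m f.1 * m.prod fun i e => (if i < t then 1 else 0) ^ e

/-- `p` is the principal specialization `ps¹(f)` of `f`, as a polynomial function of an integer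
variable `t`: for natural numbers `t` it is the value of `f` at `1, …, 1, 0, 0, …` with `t` ones, and
it is a linear combination of the polynomials `t ↦ binom(t, k)`. Over a field of characteristic
zero these are exactly the polynomial functions of `t`; the binomial form makes sense in every
characteristic. By `IsPrincipalSpec.unique` there is at most one such `p`. -/
def IsPrincipalSpec (f : QSym R) (p : ℤ → R) : Prop :=
  (∀ t : ℕ, p t = evalOnes f t) ∧
    ∃ c : ℕ →₀ R, ∀ t : ℤ, p t = c.sum fun k a => a * (Ring.choose t k : ℤ)

theorem IsPrincipalSpec.unique {f : QSym R} {p p' : ℤ → R} (h : IsPrincipalSpec f p)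
    (h' : IsPrincipalSpec f p') : p = p' := by
  obtain ⟨h, c, hc⟩ := h
  obtain ⟨h', c', hc'⟩ := h'
  have key : ∀ k, c k = c' k := by
    intro k
    induction k using Nat.strong_induction_on with
    | _ k ih =>
      have hk : p k = p' k := by rw [h, h']
      have hs : ∀ d : ℕ →₀ R, (d.sum fun j a => a * ((Ring.choose (k : ℤ) j : ℤ) : R)) =
          (∑ j ∈ Finset.range k, d j * (k.choose j : R)) + d k := by
        intro d
        have h1 : (d.sum fun j a => a * ((Ring.choose (k : ℤ) j : ℤ) : R)) =
            ∑ j ∈ d.support ∪ Finset.range (k + 1), d j * (k.choose j : R) := by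
          rw [Finsupp.sum_of_support_subset d
            (Finset.subset_union_left (s₂ := Finset.range (k + 1))) _ (by simp)]
          simp [Ring.choose_natCast]
        rw [h1, ← Finset.sum_subset (Finset.subset_union_right (s₁ := d.support)),
          Finset.sum_range_succ]
        · simp
        · intro j _ hj
          rw [Finset.mem_range, not_lt] at hj
          rw [Nat.choose_eq_zero_of_lt hj]
          simp
      rw [hc, hc', hs, hs] at hk
      rw [Finset.sum_congr rfl fun j hj => by rw [ih j (Finset.mem_range.1 hj)]] at hk
      exact add_left_cancel hk
  have : c = c' := Finsupp.ext key
  subst this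
  funext t
  rw [hc, hc']

end QuasiSymmetric

/-! ### The characters -/

section Characters

theorem Complex.IsIso.dim_le {Γ Θ : Complex.{u}} {e : Γ.V ≃ Θ.V} (h : IsIso Γ Θ e) :
    Γ.dim ≤ Θ.dim := by
  unfold Complex.dim
  refine iSup₂_le fun X hX => ?_
  have := le_iSup₂ (f := fun (Y : Finset Θ.V) (_ : Y ∈ Θ.faces) =>
    ((Y.card - 1 : ℕ) : WithBot ℕ∞)) _ ((h X).1 hX)
  simpa using this

theorem Complex.IsIso.adj {Γ Θ : Complex.{u}} {e : Γ.V ≃ Θ.V} (h : IsIso Γ Θ e) {a b : Γ.V}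
    (hab : Γ.skeletonOne.Adj a b) : Θ.skeletonOne.Adj (e a) (e b) := by
  obtain ⟨hne, X, hX, hx⟩ := hab
  refine ⟨e.injective.ne hne, _, (h X).1 hX, fun x => ?_⟩
  obtain ⟨y, rfl⟩ := e.surjective x
  simp [hx]

theorem graphRank_congr {V W : Type u} {G : SimpleGraph V} {H : SimpleGraph W} (e : G ≃g H) :
    graphRank G = graphRank H := by
  have key : ∀ {V W : Type u} {G : SimpleGraph V} {H : SimpleGraph W}, (G ≃g H) → ∀ k,
      (∃ L : SimpleGraph V, L ≤ G ∧ L.IsAcyclic ∧ L.edgeSet.ncard = k) →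
      (∃ L : SimpleGraph W, L ≤ H ∧ L.IsAcyclic ∧ L.edgeSet.ncard = k) := by
    rintro V W G H e k ⟨L, hL, hac, hk⟩
    let i : L ≃g L.map e.toEquiv.toEmbedding := SimpleGraph.Iso.map e.toEquiv L
    refine ⟨L.map e.toEquiv.toEmbedding, ?_, i.isAcyclic_iff.1 hac, ?_⟩
    · rw [SimpleGraph.map_le_iff_le_comap]
      intro a b hab
      exact e.map_adj_iff.2 (hL hab)
    · rw [← hk]
      exact (Nat.card_congr i.mapEdgeSet).symm
  unfold graphRank
  congr 1
  ext k
  exact ⟨key e k, key e.symm k⟩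

variable {R : Type v} [CommRing R]

open Classical in
/-- The value `ζ_{s,q}(Γ) = q^{rk(Γ^{(1)})} ζ_s(Γ)`, where `ζ_s(Γ)` is `1` if `dim Γ < s` and `0`
otherwise. -/
noncomputable def zetaComplex (s : ℕ) (q : R) (Γ : Complex.{u}) : R :=
  q ^ graphRank Γ.skeletonOne * if Γ.dim < (s : WithBot ℕ∞) then 1 else 0

/-- The linear functional `ζ_{s,q} : 𝒜 → R`. -/
noncomputable def zeta (s : ℕ) (q : R) : Alg.{u, v} R →ₗ[R] R :=
  Finsupp.linearCombination R fun c : IsoClass.{u} =>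
    Quotient.lift (zetaComplex s q) (by
      rintro Γ Θ ⟨e, h⟩
      have hd : Γ.dim = Θ.dim := le_antisymm h.dim_le h.symm.dim_le
      have hr : graphRank Γ.skeletonOne = graphRank Θ.skeletonOne :=
        graphRank_congr
          { toEquiv := e
            map_rel_iff' := ⟨fun hab => by simpa using h.symm.adj hab, h.adj⟩ }
      simp only [zetaComplex, hd, hr]) c

end Characters

/-- A finite graph, regarded as a simplicial complex of dimension at most one: the faces are the
vertices and the edges. -/
def ofGraph {V : Type u} [Finite V] [DecidableEq V] (G : SimpleGraph V) : Complex.{u} where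
  V := V
  faces := Geometry.AbstractSimplicialComplex.ofSimpleGraph G

end SimplicialHopf

/-!
Iterating the coproduct splits the vertex set into an ordered sequence of blocks, so if
`ζ(Γ_∅) = 1`, the coefficient of `x^m` in `Ψ_ζ(Γ)` is the sum of `∏ i, ζ(Γ_{g⁻¹ i})` over the
colorings `g : V → ℕ` using each color `i` exactly `m i` times. Setting `t` variables to `1`
therefore sums this product over all colorings `g : V → Fin t`.

For a forest `Γ` and `ζ = ζ_{s,x}` with `s > 1`, the rank of `Γ_{g⁻¹ i}` is its number of edges, so
that the summand is `x` to the number of monochromatic edges: the value is the partition function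
of the Potts model. Given the color of its neighbor, a leaf contributes a factor `t - 1 + x`, so
stripping leaves off a tree gives `t (t - 1 + x)^(n - 1)`. This is a polynomial in `t`, hence a
combination of the `binom(t, k)`, and putting `t = -1` and `x = -q` gives the claim.
-/

namespace SimplicialHopf

universe u v

section TensorFunctional

variable {R M : Type*} [CommSemiring R] [AddCommMonoid M] [Module R M] {k : ℕ}

/-- The functional `φ₀ ⊗ ⋯ ⊗ φₖ₋₁` on the `k`-th tensor power, followed by the multiplication
of `R`. -/
noncomputable def tensorFunctional (φ : Fin k → M →ₗ[R] R) : ⨂[R]^k M →ₗ[R] R :=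
  PiTensorProduct.lift ((MultilinearMap.mkPiAlgebra R (Fin k) R).compLinearMap φ)

theorem tensorFunctional_tprod (φ : Fin k → M →ₗ[R] R) (m : Fin k → M) :
    tensorFunctional φ (PiTensorProduct.tprod R m) = ∏ i, φ i (m i) := by
  simp [tensorFunctional, PiTensorProduct.lift.tprod]

theorem tensorFunctional_mulEquiv_tmul (φ : Fin (k + 1) → M →ₗ[R] R) (a : ⨂[R]^k M) (m : M) :
    tensorFunctional φ (TensorPower.mulEquiv
        (a ⊗ₜ[R] (PiTensorProduct.subsingletonEquiv (0 : Fin 1)).symm m)) =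
      tensorFunctional (fun i => φ i.castSucc) a * φ (Fin.last k) m := by
  have subsingletonEquiv_symm : (PiTensorProduct.subsingletonEquiv (R := R)
      (s := fun _ : Fin 1 => M) 0).symm m = PiTensorProduct.tprod R fun _ => m := by
    rw [LinearEquiv.symm_apply_eq, PiTensorProduct.subsingletonEquiv_apply_tprod]
  induction a using PiTensorProduct.induction_on with
  | smul_tprod r f =>
    rw [← TensorProduct.smul_tmul', map_smul, map_smul, map_smul, subsingletonEquiv_symm,
      ← TensorPower.gMul_def, TensorPower.tprod_mul_tprod, tensorFunctional_tprod,
      tensorFunctional_tprod, smul_mul_assoc, Fin.prod_univ_castSucc]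
    congr 2
    · exact Finset.prod_congr rfl fun i _ => congrArg _ (Fin.append_left f (fun _ : Fin 1 => m) i)
    · exact congrArg _ (Fin.append_right f (fun _ : Fin 1 => m) 0)
  | add a b ha hb =>
    rw [TensorProduct.add_tmul, map_add, map_add, ha, hb, map_add, add_mul]

end TensorFunctional

section ExtendLast

variable {V : Type*} {k : ℕ} {T : Set V} (h : T → Fin k)

/-- The extension of a coloring `h` of `T ⊆ V` to a coloring of `V` which gives the
elements outside of `T` one new last color. -/
noncomputable def extendLast : V → Fin (k + 1) :=
  Function.extend Subtype.val (Fin.castSucc ∘ h) fun _ => Fin.last k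

theorem extendLast_apply_coe (v : T) : extendLast h v = (h v).castSucc :=
  Subtype.val_injective.extend_apply _ _ v

theorem extendLast_apply_of_notMem {v : V} (hv : v ∉ T) : extendLast h v = Fin.last k :=
  Function.extend_apply' _ _ _ (by simpa using hv)

theorem extendLast_preimage_last : extendLast h ⁻¹' {Fin.last k} = Tᶜ := by
  ext v
  by_cases hv : v ∈ T
  · simp [hv, extendLast_apply_coe h ⟨v, hv⟩, Fin.castSucc_ne_last]
  · simp [hv, extendLast_apply_of_notMem]

theorem extendLast_preimage_castSucc (i : Fin k) :
    extendLast h ⁻¹' {i.castSucc} = Subtype.val '' (h ⁻¹' {i}) := by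
  ext v
  by_cases hv : v ∈ T
  · simp [hv, extendLast_apply_coe h ⟨v, hv⟩]
  · simp [hv, extendLast_apply_of_notMem, (Fin.castSucc_ne_last i).symm]

theorem extendLast_injective : Function.Injective (extendLast : (T → Fin k) → _) := by
  intro h h' heq
  funext v
  simpa only [extendLast_apply_coe, Fin.castSucc_inj] using congrFun heq v

theorem exists_extendLast_eq (f : V → Fin (k + 1)) :
    ∃ h : (f ⁻¹' {Fin.last k}ᶜ : Set V) → Fin k, extendLast h = f := by
  refine ⟨fun v => (f v).castPred v.2, funext fun v => ?_⟩
  by_cases hv : f v = Fin.last k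
  · rw [extendLast_apply_of_notMem _ (by simpa using hv), hv]
  · exact extendLast_apply_coe _ (⟨v, hv⟩ : (f ⁻¹' {Fin.last k}ᶜ : Set V))

theorem finsum_extendLast [Finite V] {M : Type*} [AddCommMonoid M] (F : (V → Fin (k + 1)) → M) :
    ∑ᶠ (T : Set V) (h : T → Fin k), F (extendLast h) = ∑ᶠ f, F f := by
  have bijective : Function.Bijective
      fun p : (Σ T : Set V, T → Fin k) => extendLast p.2 := by
    refine ⟨?_, fun f => ⟨⟨_, _⟩, (exists_extendLast_eq f).choose_spec⟩⟩
    rintro ⟨T, h⟩ ⟨T', h'⟩ heq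
    obtain rfl : T = T' := by
      rw [← compl_inj_iff, ← extendLast_preimage_last h, ← extendLast_preimage_last h']
      exact congrArg (· ⁻¹' _) heq
    exact congrArg (Sigma.mk T) (extendLast_injective heq)
  rw [← finsum_eq_of_bijective _ bijective fun _ => rfl]
  classical
  have := Fintype.ofFinite V
  simp only [finsum_eq_sum_of_fintype, Fintype.sum_sigma]

end ExtendLast

section IteratedCoproduct

variable {R : Type v} [CommRing R]

theorem basisElt_induced_induced (Γ : Complex.{u}) (S : Set Γ.V) (U : Set (Γ.induced S).V) :
    basisElt R ((Γ.induced S).induced U) = basisElt R (Γ.induced (Subtype.val '' U)) := by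
  have isIso : ∀ (U : Set S) (X : Finset U),
      (X.map (Function.Embedding.subtype (· ∈ U))).map (Function.Embedding.subtype (· ∈ S)) ∈
        Γ.faces ↔
      (X.map (Equiv.Set.image Subtype.val U Subtype.val_injective).toEmbedding).map
        (Function.Embedding.subtype (· ∈ Subtype.val '' U)) ∈ Γ.faces := by
    intro U X
    rw [Finset.map_map, Finset.map_map]
    rfl
  exact congrArg (Finsupp.single · 1)
    (Quotient.sound ⟨Equiv.Set.image Subtype.val U Subtype.val_injective, isIso U⟩)

theorem comul_basisElt (Γ : Complex.{u}) : comul R (basisElt R Γ) = comulComplex R Γ := by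
  rw [comul, basisElt, Finsupp.linearCombination_single, one_smul]
  rfl

open Classical in
theorem counit_basisElt (Γ : Complex.{u}) :
    counit R (basisElt R Γ) = if IsEmpty Γ.V then 1 else 0 := by
  rw [counit, basisElt, Finsupp.linearCombination_single, one_smul]
  exact if_congr Finite.card_eq_zero_iff rfl rfl

theorem tensorFunctional_iterComul_basisElt {k : ℕ} (φ : Fin k → Alg.{u, v} R →ₗ[R] R)
    (Γ : Complex.{u}) :
    tensorFunctional φ (iterComul R k (basisElt R Γ)) =
      ∑ᶠ f : Γ.V → Fin k, ∏ i, φ i (basisElt R (Γ.induced (f ⁻¹' {i}))) := by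
  induction k generalizing Γ with
  | zero =>
    rw [iterComul, LinearMap.comp_apply, counit_basisElt, LinearEquiv.coe_coe,
      PiTensorProduct.isEmptyEquiv_symm_apply, map_smul, tensorFunctional_tprod]
    simp only [Finset.univ_eq_empty, Finset.prod_empty, smul_eq_mul, mul_one]
    split_ifs with hΓ
    · rw [finsum_unique]
    · have : IsEmpty (Γ.V → Fin 0) := ⟨fun f => hΓ ⟨fun v => (f v).elim0⟩⟩
      exact (finsum_of_isEmpty _).symm
  | succ k ih =>
    rw [iterComul, LinearMap.comp_apply, LinearMap.comp_apply, comul_basisElt, comulComplex,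
      map_finsum _ (Set.toFinite _), map_finsum _ (Set.toFinite _), map_finsum _ (Set.toFinite _),
      ← finsum_extendLast]
    refine finsum_congr fun T => ?_
    rw [TensorProduct.map_tmul, LinearEquiv.coe_coe, LinearEquiv.coe_coe,
      tensorFunctional_mulEquiv_tmul, ih, finsum_mul' _ _ (Set.toFinite _)]
    refine finsum_congr fun (h : T → Fin k) => ?_
    rw [Fin.prod_univ_castSucc, extendLast_preimage_last]
    simp only [extendLast_preimage_castSucc, basisElt_induced_induced]
    rfl

end IteratedCoproduct

section Content

variable {V ι κ : Type*} [Finite V]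

/-- The exponent of the monomial `∏ v, x_{g v}` of a coloring `g` of `V`. -/
noncomputable def content (g : V → ι) : ι →₀ ℕ := ∑ᶠ v, Finsupp.single (g v) 1

theorem content_comp (g : V → ι) (e : ι → κ) : content (e ∘ g) = (content g).mapDomain e := by
  have map_content := map_finsum (Finsupp.mapDomain.addMonoidHom (M := ℕ) e)
    (f := fun v => Finsupp.single (g v) 1) (Set.toFinite _)
  simpa [content] using map_content.symm

theorem degree_content (g : V → ι) : (content g).degree = Nat.card V := by
  have := Fintype.ofFinite V
  simp [content, finsum_eq_sum_of_fintype]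

theorem content_apply (g : V → ι) (i : ι) : content g i = (g ⁻¹' {i}).ncard := by
  classical
  have := Fintype.ofFinite V
  rw [content, finsum_eq_sum_of_fintype, Finsupp.finsetSum_apply, Set.ncard_eq_toFinset_card']
  simp [Finsupp.single_apply]

theorem content_apply_ne_zero (g : V → ι) (v : V) : content g (g v) ≠ 0 := by
  rw [content_apply]
  exact ((Set.ncard_pos (Set.toFinite (g ⁻¹' {g v}))).2 ⟨v, rfl⟩).ne'

variable {R : Type*} [CommSemiring R] (z : Set V → R)

/-- The sum of the weights `∏ i, z (g⁻¹ i)` over the colorings `g` of `V` with the given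
content. For infinite `ι` the weights make sense only if `z ∅ = 1`; otherwise `∏ᶠ` is `1`. -/
noncomputable def contentSum (a : ι →₀ ℕ) : R :=
  ∑ᶠ g ∈ {g : V → ι | content g = a}, ∏ᶠ i, z (g ⁻¹' {i})

theorem setOf_content_eq_mapDomain {e : ι → κ} (he : Function.Injective e) (a : ι →₀ ℕ) :
    {g : V → κ | content g = a.mapDomain e} = (e ∘ ·) '' {f : V → ι | content f = a} := by
  ext g
  simp only [Set.mem_image, Set.mem_ofPred_eq]
  constructor
  · intro hg
    have mem_range : ∀ v, g v ∈ Set.range e := fun v => by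
      by_contra hv
      exact content_apply_ne_zero g v (hg ▸ Finsupp.mapDomain_of_notMem_range _ _ hv)
    choose f hf using mem_range
    obtain rfl : e ∘ f = g := funext hf
    exact ⟨f, Finsupp.mapDomain_injective he (content_comp f e ▸ hg), rfl⟩
  · rintro ⟨f, rfl, rfl⟩
    exact content_comp f e

theorem contentSum_mapDomain (hz : z ∅ = 1) {e : ι → κ} (he : Function.Injective e)
    (a : ι →₀ ℕ) : contentSum z (a.mapDomain e) = contentSum z a := by
  rw [contentSum, setOf_content_eq_mapDomain he, finsum_mem_image he.comp_left.injOn, contentSum]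
  refine finsum_mem_congr rfl fun f _ => ?_
  have mulSupport_subset : Function.mulSupport (fun i => z (e ∘ f ⁻¹' {i})) ⊆ Set.range e := by
    intro i hi
    by_contra hei
    have fiber_empty : e ∘ f ⁻¹' {i} = ∅ :=
      Set.preimage_singleton_eq_empty.2 fun ⟨v, hv⟩ => hei ⟨f v, hv⟩
    exact hi ((congrArg z fiber_empty).trans hz)
  rw [← finprod_mem_univ, ← finprod_mem_inter_mulSupport, Set.univ_inter,
    ← Set.inter_eq_right.2 mulSupport_subset, finprod_mem_inter_mulSupport, finprod_mem_range he]
  simp only [Set.preimage_comp, he.preimage_image, ← Set.image_singleton]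

theorem finsum_contentSum [Finite ι] :
    ∑ᶠ a : ι →₀ ℕ, contentSum z a = ∑ᶠ g : V → ι, ∏ᶠ i, z (g ⁻¹' {i}) := by
  classical
  have := Fintype.ofFinite (V → ι)
  simp only [contentSum, finsum_eq_sum_of_fintype, finsum_eq_if, Set.mem_ofPred_eq]
  rw [finsum_sum_comm _ _ fun g _ => (Set.finite_singleton (content g)).subset fun a ha => by
    by_contra h
    exact ha (if_neg fun h' => h h'.symm)]
  refine Finset.sum_congr rfl fun g _ => ?_
  rw [finsum_eq_single _ (content g) fun a ha => if_neg ha.symm, if_pos rfl]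

end Content

section Evaluation

variable {R : Type v} [CommRing R]

theorem proj_basisElt (n : ℕ) (Γ : Complex.{u}) :
    proj R n (basisElt R Γ) = if Nat.card Γ.V = n then basisElt R Γ else 0 := by
  classical
  have proj_eq_filter :
      proj R n (basisElt R Γ) = (basisElt R Γ).filter fun c => c.order = n := rfl
  rw [proj_eq_filter, basisElt]
  split_ifs with hn
  · exact Finsupp.filter_single_of_pos _ hn
  · exact Finsupp.filter_single_of_neg _ hn

theorem zetaComp_basisElt (ζ : Alg.{u, v} R →ₗ[R] R) {n : ℕ} (α : Composition n)
    (Γ : Complex.{u}) :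
    zetaComp ζ α (basisElt R Γ) = contentSum (fun S => ζ (basisElt R (Γ.induced S)))
      (Finsupp.equivFunOnFinite.symm α.blocksFun) := by
  classical
  have content_eq_iff : ∀ f : Γ.V → Fin α.length,
      content f = Finsupp.equivFunOnFinite.symm α.blocksFun ↔
        ∀ i ∈ Finset.univ, Nat.card (Γ.induced (f ⁻¹' {i})).V = α.blocksFun i := fun f => by
    simp only [Finsupp.ext_iff, content_apply, Finset.mem_univ, true_imp_iff]
    rfl
  refine (tensorFunctional_iterComul_basisElt (fun i => ζ ∘ₗ proj R (α.blocksFun i)) Γ).trans ?_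
  refine finsum_congr fun f => ?_
  rw [finsum_eq_if, finprod_eq_prod_of_fintype]
  simp only [LinearMap.comp_apply, proj_basisElt, apply_ite ζ, map_zero, Finset.prod_ite_zero]
  congr 1
  exact propext (content_eq_iff f).symm

/-- The nonzero exponents of the monomial `x^m`, in the order of the variables. It is the
composition `α` for which `x^m` occurs in `M_α`. -/
noncomputable def nonzeroExponents (m : ℕ →₀ ℕ) : List ℕ := m.support.sort.map m

theorem sum_nonzeroExponents (m : ℕ →₀ ℕ) : (nonzeroExponents m).sum = m.degree := by
  rw [nonzeroExponents, ← List.sum_toFinset _ (Finset.sort_nodup _ _), Finset.sort_toFinset]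
  rfl

theorem pos_of_mem_nonzeroExponents {m : ℕ →₀ ℕ} {e : ℕ} (he : e ∈ nonzeroExponents m) :
    0 < e := by
  obtain ⟨x, hx, rfl⟩ := List.mem_map.1 he
  exact Nat.pos_of_ne_zero (Finsupp.mem_support_iff.1 ((Finset.mem_sort _).1 hx))

theorem exists_strictMono_eq_sum_single_iff {k : ℕ} {b : Fin k → ℕ} (hb : ∀ j, 0 < b j)
    (m : ℕ →₀ ℕ) :
    (∃ i : Fin k → ℕ, StrictMono i ∧ m = ∑ j, Finsupp.single (i j) (b j)) ↔
      List.ofFn b = nonzeroExponents m := by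
  classical
  constructor
  · rintro ⟨i, hi, hm⟩
    have m_apply : ∀ j, m (i j) = b j := fun j => by
      simp [hm, Finsupp.single_apply, hi.injective.eq_iff]
    have mem_support : ∀ x, x ∈ m.support ↔ ∃ j, i j = x := fun x => by
      simp [hm, Finsupp.single_apply, (hb _).ne']
    have sort_support : m.support.sort = List.ofFn i := by
      refine m.support.sortedLT_sort.eq_of_mem_iff (List.sortedLT_ofFn_iff.2 hi) fun x => ?_
      simp only [Finset.mem_sort, mem_support, List.mem_ofFn]
    rw [nonzeroExponents, sort_support, List.map_ofFn]
    exact congrArg _ (funext fun j => (m_apply j).symm)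
  · intro h
    obtain rfl : k = m.support.sort.length := by
      simpa [nonzeroExponents] using congrArg List.length h
    have b_eq : b = m ∘ m.support.sort.get := List.ofFn_injective <| by
      rw [h, ← List.map_ofFn, List.ofFn_get, nonzeroExponents]
    refine ⟨m.support.sort.get, m.support.sortedLT_sort.strictMono_get, ?_⟩
    calc m = ∑ x ∈ m.support, Finsupp.single x (m x) := m.sum_single.symm
      _ = (m.support.sort.map fun x => Finsupp.single x (m x)).sum := by
        rw [← List.sum_toFinset _ (Finset.sort_nodup _ _), Finset.sort_toFinset]
      _ = _ := by
        rw [← Fin.sum_univ_fun_getElem]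
        simp only [b_eq]
        rfl

theorem coeff_monomialQSym {n : ℕ} (α : Composition n) (m : ℕ →₀ ℕ) :
    MvPowerSeries.coeff m (monomialQSym R α) =
      if α.blocks = nonzeroExponents m then 1 else 0 := by
  classical
  refine if_congr ?_ rfl rfl
  rw [exists_strictMono_eq_sum_single_iff α.one_le_blocksFun, α.ofFn_blocksFun]

theorem psi_basisElt (ζ : Alg.{u, v} R →ₗ[R] R) (Γ : Complex.{u}) :
    (psi ζ (basisElt R Γ)).1 =
      ∑ α : Composition (Nat.card Γ.V), zetaComp ζ α (basisElt R Γ) • monomialQSym R α := by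
  have psi_single : psi ζ (basisElt R Γ) = ∑ α : Composition (Nat.card Γ.V),
      zetaComp ζ α (basisElt R Γ) • (⟨monomialQSym R α, monomialQSym_mem R α⟩ : QSym R) := by
    rw [psi, basisElt, Finsupp.linearCombination_single, one_smul]
    rfl
  rw [psi_single, AddSubmonoidClass.coe_finsetSum]
  rfl

theorem zetaComp_basisElt_of_blocks_eq (ζ : Alg.{u, v} R →ₗ[R] R) (Γ : Complex.{u})
    (hζ : ζ (basisElt R (Γ.induced ∅)) = 1) {n : ℕ} {α : Composition n} {m : ℕ →₀ ℕ}
    (hα : α.blocks = nonzeroExponents m) :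
    zetaComp ζ α (basisElt R Γ) = contentSum (fun S => ζ (basisElt R (Γ.induced S))) m := by
  obtain ⟨i, hi, hmi⟩ := (exists_strictMono_eq_sum_single_iff α.one_le_blocksFun m).2 <|
    α.ofFn_blocksFun.trans hα
  have m_eq_mapDomain : m = (Finsupp.equivFunOnFinite.symm α.blocksFun).mapDomain i := by
    rw [hmi, Finsupp.mapDomain, Finsupp.sum_fintype _ _ fun _ => Finsupp.single_zero _]
    rfl
  rw [zetaComp_basisElt, m_eq_mapDomain, contentSum_mapDomain _ hζ hi.injective]

theorem coeff_psi_basisElt (ζ : Alg.{u, v} R →ₗ[R] R) (Γ : Complex.{u})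
    (hζ : ζ (basisElt R (Γ.induced ∅)) = 1) (m : ℕ →₀ ℕ) :
    MvPowerSeries.coeff m (psi ζ (basisElt R Γ)).1 =
      contentSum (fun S => ζ (basisElt R (Γ.induced S))) m := by
  simp only [psi_basisElt, map_sum, MvPowerSeries.coeff_smul, coeff_monomialQSym, mul_ite, mul_one,
    mul_zero]
  by_cases hm : m.degree = Nat.card Γ.V
  · let α : Composition (Nat.card Γ.V) :=
      ⟨nonzeroExponents m, pos_of_mem_nonzeroExponents, (sum_nonzeroExponents m).trans hm⟩
    rw [Finset.sum_eq_single_of_mem α (Finset.mem_univ α) fun β _ hβα => if_neg fun hβ =>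
      hβα (Composition.ext hβ), if_pos rfl, zetaComp_basisElt_of_blocks_eq ζ Γ hζ rfl]
  · have no_coloring : {g : Γ.V → ℕ | content g = m} = ∅ :=
      Set.eq_empty_of_forall_notMem fun g hg => hm (hg ▸ degree_content g)
    rw [contentSum, no_coloring, finsum_mem_empty]
    refine Finset.sum_eq_zero fun α _ => if_neg fun hα => hm ?_
    rw [← sum_nonzeroExponents, ← hα, α.blocks_sum]

theorem evalOnes_eq_finsum_coeff (f : QSym R) (t : ℕ) :
    evalOnes f t = ∑ᶠ a : Fin t →₀ ℕ, MvPowerSeries.coeff (a.mapDomain Fin.val) f.1 := by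
  rw [← finsum_mem_range (f := fun m => MvPowerSeries.coeff m f.1)
    (Finsupp.mapDomain_injective Fin.val_injective), evalOnes]
  refine finsum_congr fun m => ?_
  have m_mem_range_iff : m ∈ Set.range (Finsupp.mapDomain (M := ℕ) (Fin.val (n := t))) ↔
      ∀ i ∈ m.support, i < t := by
    rw [Finsupp.mem_range_mapDomain_iff _ Fin.val_injective, Fin.range_val]
    exact forall_congr' fun i => by rw [Finsupp.mem_support_iff, Set.mem_Iio, not_imp_comm]
  classical
  rw [finsum_eq_if, if_congr m_mem_range_iff rfl rfl]
  split_ifs with hm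
  · rw [Finsupp.prod, Finset.prod_eq_one fun i hi => by rw [if_pos (hm i hi), one_pow], mul_one]
  · push Not at hm
    obtain ⟨i, hi, hit⟩ := hm
    rw [Finsupp.prod, Finset.prod_eq_zero hi, mul_zero]
    rw [if_neg hit.not_gt, zero_pow (Finsupp.mem_support_iff.1 hi)]

theorem evalOnes_psi_basisElt (ζ : Alg.{u, v} R →ₗ[R] R) (Γ : Complex.{u})
    (hζ : ζ (basisElt R (Γ.induced ∅)) = 1) (t : ℕ) :
    evalOnes (psi ζ (basisElt R Γ)) t =
      ∑ᶠ g : Γ.V → Fin t, ∏ j, ζ (basisElt R (Γ.induced (g ⁻¹' {j}))) := by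
  simp only [evalOnes_eq_finsum_coeff, coeff_psi_basisElt ζ Γ hζ, contentSum_mapDomain
    (fun S => ζ (basisElt R (Γ.induced S))) hζ Fin.val_injective, finsum_contentSum,
    finprod_eq_prod_of_fintype]

end Evaluation

section Characters

theorem skeletonOne_induced (Γ : Complex.{u}) (S : Set Γ.V) :
    (Γ.induced S).skeletonOne = Γ.skeletonOne.induce S := by
  have adj_iff : ∀ a b : S, (a ≠ b ∧ ∃ X : Finset S,
      X.map (Function.Embedding.subtype (· ∈ S)) ∈ Γ.faces ∧ ∀ x, x ∈ X ↔ x = a ∨ x = b) ↔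
      Γ.skeletonOne.Adj a b := by
    classical
    refine fun a b => and_congr Subtype.coe_ne_coe.symm ⟨?_, ?_⟩
    · rintro ⟨X, hX, hXab⟩
      obtain rfl : X = {a, b} := by ext; simp [hXab]
      exact ⟨_, hX, fun x => by simp⟩
    · rintro ⟨X, hX, hXab⟩
      obtain rfl : X = {↑a, ↑b} := by ext; simp [hXab]
      refine ⟨{a, b}, ?_, fun x => by simp⟩
      simpa using hX
  ext a b
  exact adj_iff a b

theorem dim_induced_le (Γ : Complex.{u}) (S : Set Γ.V) : (Γ.induced S).dim ≤ Γ.dim := by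
  have le_dim : ∀ X : Finset S, X.map (Function.Embedding.subtype (· ∈ S)) ∈ Γ.faces →
      ((X.card - 1 : ℕ) : WithBot ℕ∞) ≤ Γ.dim := fun X hX => by
    rw [← Finset.card_map (Function.Embedding.subtype (· ∈ S))]
    exact le_iSup₂ (f := fun (Y : Finset Γ.V) (_ : Y ∈ Γ.faces) => ((Y.card - 1 : ℕ) : WithBot ℕ∞))
      _ hX
  exact iSup₂_le le_dim

section OfGraph

variable {V : Type u} [Finite V] [DecidableEq V] (G : SimpleGraph V)

theorem mem_ofGraph_faces (X : Finset V) :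
    X ∈ (ofGraph G).faces ↔ (∃ v, X = {v}) ∨ ∃ a b, G.Adj a b ∧ X = {a, b} := by
  have mem_faces : X ∈ (ofGraph G).faces ↔ (∃ v, X = {v}) ∨ X ∈ Sym2.toFinset '' G.edgeSet :=
    Iff.rfl
  rw [mem_faces]
  refine or_congr_right ⟨?_, ?_⟩
  · rintro ⟨⟨a, b⟩, hab, rfl⟩
    exact ⟨a, b, hab, Sym2.toFinset_mk_eq⟩
  · rintro ⟨a, b, hab, rfl⟩
    exact ⟨s(a, b), hab, Sym2.toFinset_mk_eq⟩

theorem skeletonOne_ofGraph : (ofGraph G).skeletonOne = G := by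
  have adj_iff : ∀ a b : V, (a ≠ b ∧ ∃ X : Finset V,
      X ∈ (ofGraph G).faces ∧ ∀ x, x ∈ X ↔ x = a ∨ x = b) ↔ G.Adj a b := by
    simp only [mem_ofGraph_faces]
    refine fun a b => ⟨?_, fun hab => ⟨hab.ne, {a, b}, Or.inr ⟨a, b, hab, rfl⟩, by simp⟩⟩
    rintro ⟨hab, X, ⟨v, rfl⟩ | ⟨c, d, hcd, rfl⟩, hX⟩
    · simp only [Finset.mem_singleton] at hX
      exact absurd (((hX a).2 (Or.inl rfl)).trans ((hX b).2 (Or.inr rfl)).symm) hab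
    · have hset : ({c, d} : Set V) = {a, b} := by ext x; simpa using hX x
      obtain ⟨rfl, rfl⟩ | ⟨rfl, rfl⟩ := Set.pair_eq_pair_iff.1 hset
      exacts [hcd, hcd.symm]
  ext a b
  exact adj_iff a b

theorem dim_ofGraph_le : (ofGraph G).dim ≤ 1 := by
  have card_le_two : ∀ X : Finset V, X ∈ (ofGraph G).faces → X.card ≤ 2 := fun X hX => by
    obtain ⟨v, rfl⟩ | ⟨a, b, _, rfl⟩ := (mem_ofGraph_faces G X).1 hX
    · exact (Finset.card_singleton v).trans_le one_le_two
    · exact Finset.card_le_two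
  exact iSup₂_le fun X hX => by exact_mod_cast Nat.sub_le_iff_le_add.2 (card_le_two X hX)

end OfGraph

theorem graphRank_of_isAcyclic {V : Type u} [Finite V] {G : SimpleGraph V} (hG : G.IsAcyclic) :
    graphRank G = G.edgeSet.ncard := by
  refine IsGreatest.csSup_eq ⟨⟨G, le_rfl, hG, rfl⟩, ?_⟩
  rintro _ ⟨H, hH, _, rfl⟩
  exact Set.ncard_le_ncard (SimpleGraph.edgeSet_mono hH) (Set.toFinite _)

variable {R : Type v} [CommRing R]

theorem zeta_basisElt (s : ℕ) (x : R) (Γ : Complex.{u}) :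
    zeta s x (basisElt R Γ) = zetaComplex s x Γ := by
  rw [zeta, basisElt, Finsupp.linearCombination_single, one_smul]
  rfl

theorem zeta_induced_ofGraph {V : Type u} [Finite V] [DecidableEq V] {G : SimpleGraph V}
    (hG : G.IsAcyclic) {s : ℕ} (hs : 1 < s) (x : R) (S : Set V) :
    zeta s x (basisElt R ((ofGraph G).induced S)) = x ^ (G.induce S).edgeSet.ncard := by
  have dim_lt : ((ofGraph G).induced S).dim < (s : WithBot ℕ∞) :=
    (dim_induced_le _ _).trans_lt ((dim_ofGraph_le G).trans_lt (by exact_mod_cast hs))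
  have skeleton_eq : ((ofGraph G).induced S).skeletonOne = G.induce S :=
    (skeletonOne_induced (ofGraph G) S).trans
      (congrArg (SimpleGraph.induce S) (skeletonOne_ofGraph G))
  rw [zeta_basisElt, zetaComplex, if_pos dim_lt, mul_one]
  exact congrArg (x ^ ·) ((congrArg graphRank skeleton_eq).trans
    (graphRank_of_isAcyclic (hG.induce S)))

end Characters

section Potts

variable {V ι : Type*}

theorem image_edgeSet_induce (G : SimpleGraph V) (S : Set V) :
    Sym2.map Subtype.val '' (G.induce S).edgeSet = {e ∈ G.edgeSet | ∀ v ∈ e, v ∈ S} := by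
  ext e
  constructor
  · rintro ⟨⟨a, b⟩, hab, rfl⟩
    exact ⟨hab, by simp⟩
  · induction e with
    | _ a b =>
      rintro ⟨hab, hS⟩
      simp only [Sym2.mem_iff, forall_eq_or_imp, forall_eq] at hS
      exact ⟨s(⟨a, hS.1⟩, ⟨b, hS.2⟩), hab, rfl⟩

theorem ncard_image_sym2Map_val {S : Set V} (E : Set (Sym2 S)) :
    (Sym2.map Subtype.val '' E).ncard = E.ncard :=
  Set.ncard_image_of_injective E (Sym2.map.injective Subtype.val_injective)

/-- The edges of `G` whose two ends have the same color under `g`. -/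
def monochromaticEdges (G : SimpleGraph V) (g : V → ι) : Set (Sym2 V) :=
  {e ∈ G.edgeSet | (e.map g).IsDiag}

theorem sum_ncard_edgeSet_induce_fiber [Finite V] [Fintype ι] (G : SimpleGraph V) (g : V → ι) :
    ∑ i, (G.induce (g ⁻¹' {i})).edgeSet.ncard = (monochromaticEdges G g).ncard := by
  have monochromaticEdges_eq : monochromaticEdges G g =
      ⋃ i, Sym2.map Subtype.val '' (G.induce (g ⁻¹' {i})).edgeSet := by
    ext e
    induction e with
    | _ a b =>
      simp only [image_edgeSet_induce, monochromaticEdges, Set.mem_iUnion, Set.mem_ofPred_eq,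
        Sym2.map_mk, Sym2.mk_isDiag_iff, Sym2.mem_iff, forall_eq_or_imp, forall_eq,
        Set.mem_preimage, Set.mem_singleton_iff, exists_and_left, exists_eq_left']
      exact and_congr_right' eq_comm
  have disjoint : Pairwise fun i j =>
      Disjoint (Sym2.map Subtype.val '' (G.induce (g ⁻¹' {i})).edgeSet)
        (Sym2.map Subtype.val '' (G.induce (g ⁻¹' {j})).edgeSet) := fun i j hij => by
    simp only [image_edgeSet_induce]
    refine Set.disjoint_left.2 fun e hi hj => hij ?_
    exact (hi.2 _ e.out_fst_mem).symm.trans (hj.2 _ e.out_fst_mem)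
  rw [monochromaticEdges_eq, Set.ncard_iUnion_of_finite (fun _ => Set.toFinite _) disjoint,
    finsum_eq_sum_of_fintype]
  simp only [ncard_image_sym2Map_val]

theorem image_monochromaticEdges_induce (G : SimpleGraph V) (S : Set V) (g : V → ι) :
    Sym2.map Subtype.val '' monochromaticEdges (G.induce S) (g ∘ Subtype.val) =
      {e ∈ monochromaticEdges G g | ∀ v ∈ e, v ∈ S} := by
  have monochromaticEdges_eq : monochromaticEdges (G.induce S) (g ∘ Subtype.val) =
      (G.induce S).edgeSet ∩ Sym2.map Subtype.val ⁻¹' {e | (e.map g).IsDiag} := by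
    ext e
    simp [monochromaticEdges, Sym2.map_map]
  rw [monochromaticEdges_eq, Set.image_inter_preimage, image_edgeSet_induce]
  ext e
  exact and_right_comm

open Classical in
theorem ncard_monochromaticEdges_of_leaf [Finite V] {G : SimpleGraph V} {v u : V}
    (hvu : G.Adj v u) (hu : ∀ w, G.Adj v w → w = u) (g : V → ι) :
    (monochromaticEdges G g).ncard = (if g v = g u then 1 else 0) +
      (monochromaticEdges (G.induce {v}ᶜ) (g ∘ Subtype.val)).ncard := by
  have edges_at_leaf : monochromaticEdges G g ∩ {e | v ∈ e} =
      if g v = g u then {s(v, u)} else ∅ := by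
    have eq_of_mem : ∀ e ∈ monochromaticEdges G g ∩ {e | v ∈ e}, e = s(v, u) ∧ g v = g u := by
      rintro _ ⟨⟨hadj, hdiag⟩, w, rfl⟩
      obtain rfl := hu w hadj
      exact ⟨rfl, hdiag⟩
    split_ifs with hg
    · exact Set.eq_singleton_iff_unique_mem.2
        ⟨⟨⟨hvu, hg⟩, Sym2.mem_mk_left v u⟩, fun e he => (eq_of_mem e he).1⟩
    · exact Set.eq_empty_of_forall_notMem fun e he => hg (eq_of_mem e he).2
  have edges_off_leaf : monochromaticEdges G g \ {e | v ∈ e} =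
      Sym2.map Subtype.val '' monochromaticEdges (G.induce {v}ᶜ) (g ∘ Subtype.val) := by
    rw [image_monochromaticEdges_induce]
    ext e
    exact and_congr_right' ⟨fun hv w hw hwv => hv (hwv ▸ hw), fun hv hve => hv v hve rfl⟩
  rw [← Set.ncard_inter_add_ncard_sdiff_eq_ncard _ {e | v ∈ e} (Set.toFinite _), edges_at_leaf,
    edges_off_leaf, ncard_image_sym2Map_val]
  split_ifs <;> simp

theorem finsum_apply_restrict_compl_singleton [Finite V] [Finite ι] {M : Type*} [AddCommMonoid M]
    (v : V) (F : ι → (({v}ᶜ : Set V) → ι) → M) :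
    ∑ᶠ g : V → ι, F (g v) (g ∘ Subtype.val) = ∑ᶠ (f) (a), F a f := by
  classical
  have := finsum_comp_equiv (Equiv.funSplitAt v ι) (f := fun p => F p.1 p.2)
  refine this.trans ?_
  rw [← finsum_comp_equiv (Equiv.prodComm _ _)]
  exact finsum_curry _ (Set.toFinite _)

variable {R : Type*} [CommRing R]

open Classical in
theorem finsum_pow_ite_eq [Finite ι] (x : R) (b : ι) :
    ∑ᶠ a : ι, x ^ (if a = b then 1 else 0) = Nat.card ι - 1 + x := by
  have := Fintype.ofFinite ι
  have summand_eq : ∀ a : ι, x ^ (if a = b then 1 else 0) = 1 + if a = b then x - 1 else 0 := by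
    intro a
    split_ifs <;> ring
  simp only [summand_eq, finsum_eq_sum_of_fintype, Finset.sum_add_distrib, Finset.sum_ite_eq',
    Finset.mem_univ, if_true, Finset.sum_const, Finset.card_univ, Nat.card_eq_fintype_card]
  ring

theorem finsum_pow_ncard_monochromaticEdges_of_leaf [Finite V] [Finite ι] {G : SimpleGraph V}
    {v u : V} (hvu : G.Adj v u) (hu : ∀ w, G.Adj v w → w = u) (x : R) :
    ∑ᶠ g : V → ι, x ^ (monochromaticEdges G g).ncard = (Nat.card ι - 1 + x) *
      ∑ᶠ f : ({v}ᶜ : Set V) → ι, x ^ (monochromaticEdges (G.induce {v}ᶜ) f).ncard := by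
  classical
  calc ∑ᶠ g : V → ι, x ^ (monochromaticEdges G g).ncard
    _ = ∑ᶠ (f : ({v}ᶜ : Set V) → ι) (a : ι), x ^ (if a = f ⟨u, hvu.ne'⟩ then 1 else 0) *
          x ^ (monochromaticEdges (G.induce {v}ᶜ) f).ncard := by
      simp only [ncard_monochromaticEdges_of_leaf hvu hu, pow_add]
      exact finsum_apply_restrict_compl_singleton v fun a f =>
        x ^ (if a = f ⟨u, hvu.ne'⟩ then 1 else 0) *
          x ^ (monochromaticEdges (G.induce {v}ᶜ) f).ncard
    _ = ∑ᶠ f : ({v}ᶜ : Set V) → ι, (Nat.card ι - 1 + x) *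
          x ^ (monochromaticEdges (G.induce {v}ᶜ) f).ncard := by
      simp only [← finsum_mul' _ _ (Set.toFinite _), finsum_pow_ite_eq]
    _ = _ := (mul_finsum' _ _ (Set.toFinite _)).symm

theorem finsum_pow_ncard_monochromaticEdges_of_isTree [Finite V] [Finite ι] {G : SimpleGraph V}
    (hG : G.IsTree) (x : R) :
    ∑ᶠ g : V → ι, x ^ (monochromaticEdges G g).ncard =
      Nat.card ι * (Nat.card ι - 1 + x) ^ (Nat.card V - 1) := by
  classical
  have := hG.connected.nonempty
  obtain ⟨n, hn⟩ := Nat.exists_eq_add_one.2 (Nat.card_pos (α := V))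
  rw [hn, Nat.add_sub_cancel]
  induction n generalizing V with
  | zero =>
    obtain ⟨_, _⟩ := Nat.card_eq_one_iff_unique.1 hn
    have no_edges : ∀ g : V → ι, monochromaticEdges G g = ∅ := fun g => by
      rw [monochromaticEdges, Subsingleton.elim G ⊥]
      simp
    have := Fintype.ofFinite (V → ι)
    simp only [no_edges, Set.ncard_empty, pow_zero]
    rw [finsum_eq_sum_of_fintype, Finset.sum_const, Finset.card_univ, nsmul_one, mul_one,
      ← Nat.card_eq_fintype_card, Nat.card_fun, hn, pow_one]
  | succ n ih =>
    have := Fintype.ofFinite V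
    have : Nontrivial V := Finite.one_lt_card_iff_nontrivial.1 (by lia)
    obtain ⟨v, hv⟩ := hG.exists_vert_degree_one_of_nontrivial
    obtain ⟨u, hvu, hu⟩ := SimpleGraph.degree_eq_one_iff_existsUnique_adj.1 hv
    have isTree_induce : (G.induce {v}ᶜ).IsTree :=
      ⟨hG.connected.induce_compl_singleton_of_degree_eq_one hv, hG.isAcyclic.induce _⟩
    have card_compl : Nat.card ({v}ᶜ : Set V) = n + 1 := by
      rw [Nat.card_coe_set_eq, Set.ncard_compl, Set.ncard_singleton, hn, Nat.add_sub_cancel]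
    rw [finsum_pow_ncard_monochromaticEdges_of_leaf hvu hu,
      ih isTree_induce isTree_induce.connected.nonempty card_compl, pow_succ']
    ring

end Potts

section Binomial

variable (R : Type*) [CommRing R]

/-- The functions on the integers which are `R`-linear combinations of the binomial polynomials
`t ↦ binom(t, k)`. -/
def binomialSpan : Submodule R (ℤ → R) :=
  Submodule.span R (Set.range fun (k : ℕ) (t : ℤ) => ((Ring.choose t k : ℤ) : R))

variable {R}

theorem mem_binomialSpan_iff {p : ℤ → R} :
    p ∈ binomialSpan R ↔
      ∃ c : ℕ →₀ R, ∀ t : ℤ, p t = c.sum fun k a => a * (Ring.choose t k : ℤ) := by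
  simp only [binomialSpan, Finsupp.mem_span_range_iff_exists_finsupp, funext_iff, Finsupp.sum,
    Finset.sum_apply, Pi.smul_apply, smul_eq_mul, eq_comm]

theorem choose_mem_binomialSpan (k : ℕ) :
    (fun t : ℤ => ((Ring.choose t k : ℤ) : R)) ∈ binomialSpan R :=
  Submodule.subset_span ⟨k, rfl⟩

theorem self_mul_choose (t : ℤ) (k : ℕ) :
    t * Ring.choose t k = (k + 1) * Ring.choose t (k + 1) + k * Ring.choose t k := by
  have succ_mul_choose_succ : (k + 1) * Ring.choose t (k + 1) = Ring.choose t k * (t - k) := by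
    have := Ring.choose_smul_choose t k.le_succ
    rw [Nat.succ_eq_add_one, Nat.choose_succ_self_right, Nat.add_sub_cancel_left,
      Ring.choose_one_right] at this
    simpa using this
  rw [succ_mul_choose_succ]
  ring

theorem intCast_mul_mem_binomialSpan {p : ℤ → R} (hp : p ∈ binomialSpan R) :
    Int.cast * p ∈ binomialSpan R := by
  suffices binomialSpan R ≤ (binomialSpan R).comap (LinearMap.mulLeft R Int.cast) from this hp
  refine Submodule.span_le.2 ?_
  rintro _ ⟨k, rfl⟩
  have mul_choose_eq : (Int.cast * fun t : ℤ => ((Ring.choose t k : ℤ) : R)) =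
      ((k + 1 : R) • fun t : ℤ => ((Ring.choose t (k + 1) : ℤ) : R)) +
        (k : R) • fun t : ℤ => ((Ring.choose t k : ℤ) : R) := by
    ext t
    simpa using congrArg (Int.cast (R := R)) (self_mul_choose t k)
  simp only [SetLike.mem_coe, Submodule.mem_comap, LinearMap.mulLeft_apply, mul_choose_eq]
  exact add_mem (Submodule.smul_mem _ _ (choose_mem_binomialSpan (k + 1)))
    (Submodule.smul_mem _ _ (choose_mem_binomialSpan k))

theorem eval_intCast_mem_binomialSpan (p : Polynomial R) :
    (fun t : ℤ => p.eval (t : R)) ∈ binomialSpan R := by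
  induction p using Polynomial.induction_on with
  | C a =>
    simpa [Pi.smul_def] using Submodule.smul_mem _ a (choose_mem_binomialSpan 0)
  | add p q hp hq =>
    simp only [Polynomial.eval_add]
    exact add_mem hp hq
  | monomial n a h =>
    convert intCast_mul_mem_binomialSpan h using 1
    ext t
    simp only [Polynomial.eval_mul, Polynomial.eval_C, Polynomial.eval_pow, Polynomial.eval_X,
      Pi.mul_apply]
    ring

end Binomial

theorem evalOnes_psi_ofGraph_of_isAcyclic {R : Type v} [CommRing R] {V : Type u} [Finite V]
    [DecidableEq V] {G : SimpleGraph V} (hG : G.IsAcyclic) {s : ℕ} (hs : 1 < s) (x : R) (t : ℕ) :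
    evalOnes (psi (zeta s x) (basisElt R (ofGraph G))) t =
      ∑ᶠ g : V → Fin t, x ^ (monochromaticEdges G g).ncard := by
  have zeta_induced_empty : zeta s x (basisElt R ((ofGraph G).induced ∅)) = 1 := by
    refine (zeta_induced_ofGraph hG hs x ∅).trans ?_
    rw [Set.eq_empty_of_isEmpty (G.induce ∅).edgeSet, Set.ncard_empty, pow_zero]
  rw [evalOnes_psi_basisElt _ _ zeta_induced_empty]
  refine finsum_congr fun (g : V → Fin t) => ?_
  rw [← sum_ncard_edgeSet_induce_fiber, ← Finset.prod_pow_eq_pow_sum]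
  exact Finset.prod_congr rfl fun i _ => zeta_induced_ofGraph hG hs x _

end SimplicialHopf

open SimplicialHopf Polynomial in
theorem mainTheorem10_general {R : Type*} [CommRing R] {V : Type*} [Finite V] [DecidableEq V]
    {T : SimpleGraph V} (hT : T.IsTree) {s : ℕ} (hs : 1 < s) (x : R) :
    IsPrincipalSpec (psi (zeta s x) (basisElt R (ofGraph T)))
      fun t => t * (t - 1 + x) ^ (Nat.card V - 1) := by
  refine ⟨fun t => ?_, mem_binomialSpan_iff.1 ?_⟩
  · rw [evalOnes_psi_ofGraph_of_isAcyclic hT.isAcyclic hs,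
      finsum_pow_ncard_monochromaticEdges_of_isTree hT, Nat.card_fin]
    simp only [Int.cast_natCast]
  · have eval_mem := eval_intCast_mem_binomialSpan (X * (X - 1 + C x) ^ (Nat.card V - 1))
    simpa only [eval_mul, eval_X, eval_pow, eval_add, eval_sub, eval_one, eval_C] using eval_mem

theorem mainTheorem10 {K : Type*} [Field K] {V : Type*} [Finite V] [DecidableEq V]
    (T : SimpleGraph V) (hT : T.IsTree) (s : ℕ) (hs : 1 < s) :
    ∃ p : ℤ → RatFunc K,
      SimplicialHopf.IsPrincipalSpec
        (SimplicialHopf.psi (SimplicialHopf.zeta s (-RatFunc.X : RatFunc K))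
          (SimplicialHopf.basisElt (RatFunc K) (SimplicialHopf.ofGraph T))) p ∧
      p (-1) = (-1) ^ Nat.card V * (RatFunc.X + 2) ^ (Nat.card V - 1) := by
  refine ⟨_, mainTheorem10_general hT hs _, ?_⟩
  have := hT.connected.nonempty
  have base_eq : ((-1 : ℤ) : RatFunc K) - 1 + -RatFunc.X = -1 * (RatFunc.X + 2) := by
    push_cast
    ring
  simp only [base_eq]
  rw [mul_pow, ← mul_assoc, Int.cast_neg, Int.cast_one, mul_pow_sub_one Nat.card_pos.ne']
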